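/- For $n \ge 4$ let $X_1(n)$ be the smooth projective modular curve over $\mathbb{Q}$ that compactifies the affine curve $Y_1(n)$, whose $K$-rational points, for a field $K \supseteq \mathbb{Q}$, classify the isomorphism classes of pairs $(E,P)$ consisting of an elliptic curve $E$ over $K$ and a point $P \in E(K)$ of exact order $n$. The curve $X_1(14)$ is an elliptic curve over $\mathbb{Q}$, with Weierstrass model $y^2+xy+y=x^3-x$. For a nonzero $d\in\mathbb{Q}$ let $X_1^{(d)}(14)$ denote its quadratic twist by $d$. **Theorem.** Let $p$ be a prime with $p \equiv 3 \pmod 8$ and $\left(\frac{p}{7}\right)=1$. Then $$\operatorname{rank}\bigl(X_1^{(p)}(14)(\mathbb{Q})\bigr)=\operatorname{rank}\bigl(X_1^{(-7p)}(14)(\mathbb{Q})\bigr)=0 .$$ -/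

import Mathlib

noncomputable section

/-- The primality of `7`, needed for the Legendre symbol modulo `7`. -/
instance fact_prime_seven : Fact (Nat.Prime 7) := ⟨by norm_num⟩

/-- The quadratic twist `E^{(d)}` of a Weierstrass curve `E` over `ℚ`. Completing the square in
`E` gives `Y² = x³ + (b₂/4) x² + (b₄/2) x + b₆/4`, and the twist `d Y² = (same cubic)` becomes,
after scaling `x` by `d` and `Y` by `d²`, the Weierstrass curve below. -/
def WeierstrassCurve.quadraticTwist (E : WeierstrassCurve ℚ) (d : ℚ) : WeierstrassCurve ℚ where
  a₁ := 0
  a₂ := d * E.b₂ / 4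
  a₃ := 0
  a₄ := d ^ 2 * E.b₄ / 2
  a₆ := d ^ 3 * E.b₆ / 4

/-- The rank of the Mordell-Weil group `E(ℚ)`, as the cardinal-valued rank of the abelian group of
rational points. -/
def WeierstrassCurve.rankQ (E : WeierstrassCurve ℚ) : Cardinal :=
  Module.rank ℤ E.toAffine.Point

/-- The Tate normal form `y² + (1 - c) x y - b y = x³ - b x²`. Over a field, every elliptic curve
with a point of order at least `4` is isomorphic to exactly one such curve with the point sent
to `(0, 0)`. -/
def tateNormalForm {F : Type*} [Field F] (b c : F) : WeierstrassCurve F where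
  a₁ := 1 - c
  a₂ := -b
  a₃ := -b
  a₄ := 0
  a₆ := 0

open Classical in
/-- The Tate normal form with parameters `b`, `c` is an elliptic curve on which the rational point
`(0, 0)` has exact order `n`. -/
def IsTatePair {F : Type*} [Field F] (n : ℕ) (b c : F) : Prop :=
  (tateNormalForm b c).IsElliptic ∧
    ∃ h : (tateNormalForm b c).toAffine.Nonsingular 0 0,
      addOrderOf (WeierstrassCurve.Affine.Point.some 0 0 h) = n

/-- `E` is (a Weierstrass model over `ℚ` of) the modular curve `X₁(n)`, for `n ≥ 4`.

For `n ≥ 4` the isomorphism classes of pairs (elliptic curve, point of exact order `n`) over a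
field `F ⊇ ℚ`, that is, the `F`-rational points of the affine curve `Y₁(n)`, are the pairs `(b, c)`
in `F × F` with `IsTatePair n b c`. Thus the smooth projective curve `E` is the compactification
of `Y₁(n)` exactly when its function field is generated over `ℚ` by such a pair (the generic point
of `Y₁(n)`). -/
def IsModularCurveX1 (n : ℕ) (E : WeierstrassCurve ℚ) : Prop :=
  E.IsElliptic ∧
    ∃ b c : E.toAffine.FunctionField,
      IsTatePair n b c ∧ IntermediateField.adjoin ℚ {b, c} = ⊤

/-- The elliptic curve `X₁(14)`, by its model `y² + x y + y = x³ - x`. -/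
def X1_14 : WeierstrassCurve ℚ where
  a₁ := 1
  a₂ := 0
  a₃ := 1
  a₄ := -1
  a₆ := 0

end

/-!
The model `y² + x y + y = x³ - x` is recognised as `X₁(14)` by exhibiting the universal pair. In
Tate normal form put `c = s (r - 1)`, `b = r c`; the multiples of `P = (0, 0)` up to `7 P` are
explicit rational functions of `r` and `s` (`isTatePair_fourteen`), and `7 P` is `2`-torsion exactly
when a polynomial relation of degree `2` in `r` holds. This relation is birational to the given
cubic through `s = -y / (x + 1)`, `r = y / ((x + 1) (x² + y))`, with inverse
`x = (s (2 - s) - s / r) / (s - 1)²`, `y = -s (x + 1)`, so that `ℚ(b, c)` is the whole function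
field (`exists_isTatePair_fourteen`). All elements that must not vanish have the form
`p(x) + q(x) y`, and `1, y` are linearly independent over `ℚ(x)`.

The ranks are computed by descent through the `2`-isogeny. With `X = 4 (x + d)` and `Y = 8 y` the
twist by `d` becomes `Y² = X (X² - 11 d X + 32 d²)`, and the isogenous curve is
`Y² = X (X² + 22 d X - 7 d²)`. For `d = p` and `d = -7 p` local conditions at `2`, `7` and `p` show
that a nonzero `X` lies in the square class of `1` or `2` on the first curve
(`TwistPrime.sq_class_of_onTwist`, `TwistPrime.sq_class_of_onTwist_neg_seven_mul`) and of `1` or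
`-7` on the second (`TwistPrime.sq_class_of_onIsogenousTwist`). These are the classes of the
`2`-torsion points `(0, 0)`, so every rational point `P` of the twist is of the form `2 R` or
`2 R + T` with `T` the `2`-torsion point (`exists_two_nsmul_eq_of_sq` writes `R` down). Hence
`2 P = 4 R`: the subgroup `2 E(ℚ)` is `2`-divisible. The naive height satisfies
`h(2 P) ≥ 4 h(P) - C` and has the Northcott property, so `2 E(ℚ)` is finitely generated; a finitely
generated `2`-divisible group is finite, and the rank is zero
(`WeierstrassCurve.rankQ_eq_zero_of_two_nsmul_eq_four_nsmul`).
-/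

/-! ### Heights and duplication -/

/-- On the diagonal, the addition-and-subtraction map computes the `x`-coordinate of `2 P` up to
a nonzero scalar; the third coordinate vanishes because `P - P = 0`. -/
theorem WeierstrassCurve.Affine.Point.exists_smul_xRep_two_nsmul
    {F : Type*} [Field F] [DecidableEq F] (W : WeierstrassCurve F) [W.IsElliptic]
    (P : W.toAffine.Point) :
    ∃ k : F, k ≠ 0 ∧ (fun i ↦ (W.addSubMap i).eval (P.sym2x P)) =
      k • ![(2 • P).xRep 0, (2 • P).xRep 1, 0] := by
  have hne := W.addSubMap_ne_zero (P.sym2x_ne_zero P)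
  suffices h : ∃ k : F, (fun i ↦ (W.addSubMap i).eval (P.sym2x P)) =
      k • ![(2 • P).xRep 0, (2 • P).xRep 1, 0] by
    obtain ⟨k, hk⟩ := h
    refine ⟨k, fun hk0 ↦ hne ?_, hk⟩
    rw [hk, hk0, zero_smul]
  rcases P with _ | ⟨x, y, h⟩
  · refine ⟨1, ?_⟩
    change (fun i ↦ (W.addSubMap i).eval (WeierstrassCurve.Affine.Point.sym2x 0 0)) =
      (1 : F) • ![(2 • (0 : W.toAffine.Point)).xRep 0, (2 • (0 : W.toAffine.Point)).xRep 1, 0]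
    ext i
    fin_cases i <;> simp [addSubMap, -MvPolynomial.eval_zero]
  · have heq := (WeierstrassCurve.Affine.equation_iff _ _).mp h.1
    have hsq : (y - W.toAffine.negY x y) ^ 2 =
        4 * x ^ 3 + W.b₂ * x ^ 2 + 2 * W.b₄ * x + W.b₆ := by
      simp only [WeierstrassCurve.Affine.negY, WeierstrassCurve.b₂, WeierstrassCurve.b₄,
        WeierstrassCurve.b₆]
      linear_combination 4 * heq
    by_cases hy : y = W.toAffine.negY x y
    · refine ⟨x ^ 4 - W.b₄ * x ^ 2 - 2 * W.b₆ * x - W.b₈, ?_⟩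
      rw [two_nsmul, WeierstrassCurve.Affine.Point.add_self_of_Y_eq hy]
      rw [sub_eq_zero.mpr hy] at hsq
      ext i
      fin_cases i
      · simp [addSubMap]; ring
      · simp [addSubMap]; linear_combination -hsq
      · simp [addSubMap]; ring
    · refine ⟨4 * x ^ 3 + W.b₂ * x ^ 2 + 2 * W.b₄ * x + W.b₆, ?_⟩
      rw [two_nsmul, WeierstrassCurve.Affine.Point.add_self_of_Y_ne hy]
      have h0 := sub_ne_zero.mpr hy
      ext i
      fin_cases i
      · have hnum : (3 * x ^ 2 + 2 * W.a₂ * x + W.a₄ - W.a₁ * y) ^ 2 +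
            W.a₁ * (3 * x ^ 2 + 2 * W.a₂ * x + W.a₄ - W.a₁ * y) * (y - W.toAffine.negY x y) -
            (W.a₂ + 2 * x) * (y - W.toAffine.negY x y) ^ 2 =
            x ^ 4 - W.b₄ * x ^ 2 - 2 * W.b₆ * x - W.b₈ := by
          simp only [WeierstrassCurve.Affine.negY, WeierstrassCurve.b₄, WeierstrassCurve.b₆,
            WeierstrassCurve.b₈]
          linear_combination -(W.a₁ ^ 2 + 4 * W.a₂ + 8 * x) * heq
        have hX : (y - W.toAffine.negY x y) ^ 2 *
            W.toAffine.addX x x (W.toAffine.slope x x y y) =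
            x ^ 4 - W.b₄ * x ^ 2 - 2 * W.b₆ * x - W.b₈ := by
          rw [← hnum, WeierstrassCurve.Affine.slope_of_Y_ne rfl hy, WeierstrassCurve.Affine.addX]
          field_simp
          ring
        rw [← hsq]
        simp [addSubMap, -WeierstrassCurve.Affine.addX, -WeierstrassCurve.Affine.negY, hX]
        ring
      · simp [addSubMap]; ring
      · simp [addSubMap]; ring


open Height WeierstrassCurve.Affine in
/-- Duplication multiplies the naive height by at least `4`, up to a bounded error. -/
theorem WeierstrassCurve.exists_logHeight_xRep_two_nsmul_ge {F : Type*} [Field F] [DecidableEq F]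
    [AdmissibleAbsValues F] (W : WeierstrassCurve F) [W.IsElliptic] :
    ∃ C : ℝ, ∀ P : W.toAffine.Point,
      4 * logHeight P.xRep - C ≤ logHeight (2 • P).xRep := by
  obtain ⟨C₁, hC₁⟩ := W.abs_logHeight_addSubMap_sub_two_mul_logHeight_le
  obtain ⟨C₂, hC₂⟩ := logHeight_sym2_ge F
  refine ⟨C₁ - 2 * C₂, fun P ↦ ?_⟩
  obtain ⟨k, hk, h⟩ := Point.exists_smul_xRep_two_nsmul W P
  have h1 := hC₁ (P.sym2x P)
  have hv (v : Fin 2 → F) : ![v 0, v 1] = v := by ext i; fin_cases i <;> rfl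
  have h2 := hC₂ (hv P.xRep ▸ P.xRep_ne_zero) (hv P.xRep ▸ P.xRep_ne_zero)
  rw [h, logHeight_smul_eq_logHeight _ hk, logHeight_cons_cons_cons_zero, hv] at h1
  rw [hv] at h2
  change _ ≤ logHeight (P.sym2x P) at h2
  rw [abs_le] at h1
  linarith [h1.1]

open Height WeierstrassCurve.Affine in
instance WeierstrassCurve.northcott_logHeight_xRep {F : Type*} [Field F]
    [AdmissibleAbsValues F] [Northcott (logHeight₁ (K := F))] (W : WeierstrassCurve F) :
    Northcott (fun P : W.toAffine.Point ↦ logHeight P.xRep) where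
  finite_le B := by
    refine Set.Finite.of_finite_fibers Point.xRep ?_ fun v _ ↦ ?_
    · refine (((Northcott.finite_le (h := logHeight₁ (K := F)) B).image
        fun x ↦ ![x, 1]).insert ![1, 0]).subset ?_
      rintro _ ⟨_ | ⟨x, y, h⟩, hP, rfl⟩
      · exact .inl rfl
      · refine .inr ⟨x, ?_, rfl⟩
        simpa [logHeight₁_eq_logHeight] using hP
    · classical
      by_cases hv : ∃ Q : W.toAffine.Point, Q.xRep = v
      · obtain ⟨Q, rfl⟩ := hv
        refine (Set.toFinite {Q, -Q}).subset fun P hP ↦ ?_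
        exact Point.eq_or_eq_neg_of_xRep_eq_xRep hP.2
      · exact Set.finite_empty.subset fun P hP ↦ hv ⟨P, hP.2⟩

/-- Nakayama's lemma for the ideal `(2)`: a finitely generated `2`-divisible group is killed by an
odd, in particular nonzero, integer. -/
theorem AddCommGroup.exists_zsmul_eq_zero_of_fg_of_two_divisible {G : Type*} [AddCommGroup G]
    [AddGroup.FG G] (h : ∀ g : G, ∃ g', g = 2 • g') :
    ∃ n : ℤ, n ≠ 0 ∧ ∀ g : G, n • g = 0 := by
  have : Module.Finite ℤ G := Module.Finite.iff_addGroup_fg.mpr inferInstance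
  obtain ⟨r, hr, h0⟩ := Submodule.exists_sub_one_mem_and_smul_eq_zero_of_fg_of_le_smul
    (Ideal.span {(2 : ℤ)}) (⊤ : Submodule ℤ G) Module.Finite.fg_top fun g _ ↦ by
      obtain ⟨g', rfl⟩ := h g
      have := Submodule.smul_mem_smul (Ideal.mem_span_singleton_self (2 : ℤ))
        (Submodule.mem_top (R := ℤ) (x := g'))
      rwa [ofNat_zsmul] at this
  refine ⟨r, ?_, fun g ↦ h0 g Submodule.mem_top⟩
  rintro rfl
  rw [Ideal.mem_span_singleton] at hr
  omega

open Height WeierstrassCurve.Affine in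
/-- If `2 E(ℚ) = 4 E(ℚ)` then the rank is zero. The descent theorem is applied to the `2`-divisible
group `2 E(ℚ)`, for which the single coset representative `0` suffices. -/
theorem WeierstrassCurve.rankQ_eq_zero_of_two_nsmul_eq_four_nsmul (W : WeierstrassCurve ℚ)
    [W.IsElliptic] (h : ∀ P : W.toAffine.Point, ∃ R : W.toAffine.Point, 2 • P = 4 • R) :
    W.rankQ = 0 := by
  let f : W.toAffine.Point →+ W.toAffine.Point := nsmulAddMonoidHom 2
  let A := f.range
  have hdiv : ∀ g : A, ∃ g', g = 2 • g' := by
    rintro ⟨_, P, rfl⟩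
    obtain ⟨R, hR⟩ := h P
    refine ⟨⟨f R, R, rfl⟩, Subtype.ext ?_⟩
    change 2 • P = 2 • 2 • R
    rw [hR, ← mul_nsmul]
  obtain ⟨C, hC⟩ := W.exists_logHeight_xRep_two_nsmul_ge
  have hN : Northcott fun g : A ↦ logHeight (g : W.toAffine.Point).xRep :=
    ⟨fun B ↦ Set.Finite.preimage Subtype.val_injective.injOn
      (Northcott.finite_le (h := fun P : W.toAffine.Point ↦ logHeight P.xRep) B)⟩
  have hfg : AddGroup.FG A := by
    refine AddGroup.fg_of_descent (f := nsmulAddMonoidHom 2) (s := {0})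
      (h := fun g : A ↦ logHeight (g : W.toAffine.Point).xRep) (a := 1) (b := 4) (c := max C 0)
      ?_ (by norm_num) (by norm_num) (Set.finite_singleton _) ?_ ?_ ?_
    · rintro U _ ⟨u, hu, rfl⟩
      exact U.nsmul_mem hu 2
    · refine Set.eq_univ_of_forall fun g ↦ ?_
      obtain ⟨g', rfl⟩ := hdiv g
      exact Set.mem_add.mpr ⟨0, rfl, _, ⟨g', rfl⟩, zero_add _⟩
    · rintro g rfl x
      simp
    · intro x
      have := hC x
      have h' := le_max_left C 0
      change 4 * logHeight (x : W.toAffine.Point).xRep - max C 0 ≤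
        logHeight (2 • (x : W.toAffine.Point)).xRep
      linarith
  obtain ⟨n, hn, h0⟩ := AddCommGroup.exists_zsmul_eq_zero_of_fg_of_two_divisible hdiv
  rw [rankQ, rank_eq_zero_iff]
  refine fun P ↦ ⟨n * 2, by simpa using hn, ?_⟩
  have := congrArg Subtype.val (h0 ⟨f P, P, rfl⟩)
  rw [mul_zsmul, ofNat_zsmul]
  exact this

/-! ### Square classes on `Y² = X (X² + A X + B)` -/

/-- Every nonzero rational number has a squarefree integer in its square class. -/
theorem Rat.exists_squarefree_mul_sq {x : ℚ} (hx : x ≠ 0) :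
    ∃ (b : ℤ) (r : ℚ), Squarefree b ∧ r ≠ 0 ∧ x = b * r ^ 2 := by
  have hm : x.num * x.den ≠ 0 := mul_ne_zero (Rat.num_ne_zero.mpr hx) (by exact_mod_cast x.den_nz)
  obtain ⟨a, s, has, ha⟩ := Nat.sq_mul_squarefree (x.num * x.den).natAbs
  have hden : (x.den : ℚ) ≠ 0 := by exact_mod_cast x.den_nz
  have hs0 : s ≠ 0 := by
    rintro rfl
    exact hm (by simpa using has.symm)
  have key : x * (x.den : ℚ) ^ 2 = ((x.num * x.den : ℤ) : ℚ) := by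
    nth_rewrite 1 [← Rat.num_div_den x]
    push_cast
    field_simp
  have hcast : ((x.num * x.den).natAbs : ℤ) = s ^ 2 * a := by exact_mod_cast has.symm
  rcases Int.natAbs_eq (x.num * x.den) with h | h
  · refine ⟨a, s / x.den, Int.squarefree_natCast.mpr ha, by positivity, ?_⟩
    rw [h, hcast] at key
    push_cast at key ⊢
    field_simp
    linear_combination key
  · refine ⟨-a, s / x.den, Int.squarefree_natAbs.mp (by simpa using ha), by positivity, ?_⟩
    rw [h, hcast] at key
    push_cast at key ⊢
    field_simp
    linear_combination key

/-- A rational point with `X = b r²` gives an integral point on the quartic torsor attached to the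
square class `b`, with `r = M / e` in lowest terms. -/
theorem exists_int_sq_eq_of_sq_class {A B b : ℤ} {X Y r : ℚ} (hr : r ≠ 0)
    (hX : X = b * r ^ 2) (h : Y ^ 2 = X * (X ^ 2 + A * X + B)) :
    ∃ M e n : ℤ, IsCoprime M e ∧
      n ^ 2 = b * (b ^ 2 * M ^ 4 + A * b * M ^ 2 * e ^ 2 + B * e ^ 4) := by
  have hden : (r.den : ℚ) ≠ 0 := by exact_mod_cast r.den_nz
  have hz : (Y / r * r.den ^ 2) ^ 2 = ((b * (b ^ 2 * r.num ^ 4 + A * b * r.num ^ 2 * r.den ^ 2 +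
      B * r.den ^ 4) : ℤ) : ℚ) := by
    have hr' : (r.num : ℚ) = r * r.den := (Rat.mul_den_eq_num r).symm
    push_cast
    rw [hr']
    field_simp
    rw [h, hX]
    ring
  obtain ⟨n, hn⟩ : IsSquare (b * (b ^ 2 * r.num ^ 4 + A * b * r.num ^ 2 * (r.den : ℤ) ^ 2 +
      B * (r.den : ℤ) ^ 4)) := by
    rw [← Rat.isSquare_intCast_iff, ← hz]
    exact ⟨_, sq _⟩
  exact ⟨r.num, r.den, n, Int.isCoprime_iff_gcd_eq_one.mpr r.reduced, by rw [hn, sq]⟩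

/-- Only primes dividing `B` occur in the square class: if `q ∣ b` but `q ∤ B`, the equation forces
`q ∣ e`, then `q ∣ M`. -/
theorem Prime.dvd_of_sq_eq_squarefree_mul {A B b M e n q : ℤ} (hb : Squarefree b) (hq : Prime q)
    (hqb : q ∣ b) (hMe : IsCoprime M e)
    (h : n ^ 2 = b * (b ^ 2 * M ^ 4 + A * b * M ^ 2 * e ^ 2 + B * e ^ 4)) : q ∣ B := by
  obtain ⟨c, rfl⟩ := hqb
  have hqc : ¬ q ∣ c := by
    rintro ⟨k, rfl⟩
    exact hq.not_isUnit (hb q ⟨k, by ring⟩)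
  obtain ⟨n, rfl⟩ : q ∣ n := hq.dvd_of_dvd_pow (n := 2) ⟨_, by rw [h, mul_assoc]⟩
  have h1 : q * n ^ 2 = c * ((q * c) ^ 2 * M ^ 4 + A * (q * c) * M ^ 2 * e ^ 2 + B * e ^ 4) :=
    mul_left_cancel₀ hq.ne_zero (by linear_combination h)
  have h2 : q ∣ B * e ^ 4 := by
    have : q ∣ c * (B * e ^ 4) :=
      ⟨n ^ 2 - c * (q * c ^ 2 * M ^ 4 + A * c * M ^ 2 * e ^ 2), by linear_combination -h1⟩
    exact (hq.dvd_or_dvd this).resolve_left hqc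
  refine (hq.dvd_or_dvd h2).resolve_right fun he ↦ ?_
  obtain ⟨e, rfl⟩ := hq.dvd_of_dvd_pow he
  obtain ⟨n, rfl⟩ : q ∣ n := by
    refine hq.dvd_of_dvd_pow (n := 2)
      ⟨c * (c ^ 2 * M ^ 4 + A * c * q * M ^ 2 * e ^ 2 + B * q ^ 2 * e ^ 4), ?_⟩
    exact mul_left_cancel₀ hq.ne_zero (by linear_combination h1)
  have h3 : q ∣ c * (c ^ 2 * M ^ 4) := by
    refine ⟨n ^ 2 - c * (A * c * M ^ 2 * e ^ 2 + B * q * e ^ 4), ?_⟩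
    refine mul_left_cancel₀ (pow_ne_zero 2 hq.ne_zero) ?_
    linear_combination -h1
  have hqM : q ∣ M := by
    rcases hq.dvd_or_dvd h3 with h4 | h4
    · exact absurd h4 hqc
    rcases hq.dvd_or_dvd h4 with h4 | h4
    · exact absurd (hq.dvd_of_dvd_pow h4) hqc
    · exact hq.dvd_of_dvd_pow h4
  exact hq.not_isUnit (hMe.isUnit_of_dvd' hqM (dvd_mul_right q e))

theorem Int.dvd_of_squarefree_of_forall_prime {b D : ℤ} (hb : Squarefree b)
    (h : ∀ q : ℤ, Prime q → q ∣ b → q ∣ D) : b ∣ D := by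
  rw [← Int.natAbs_dvd_natAbs, ← Nat.prod_primeFactors_of_squarefree (Int.squarefree_natAbs.mpr hb)]
  refine Finset.prod_primes_dvd _ (fun q hq ↦ (Nat.prime_of_mem_primeFactors hq).prime)
    fun q hq ↦ ?_
  have := h q (Nat.prime_iff_prime_int.mp (Nat.prime_of_mem_primeFactors hq))
    (Int.natCast_dvd.mpr (Nat.dvd_of_mem_primeFactors hq))
  exact Int.natCast_dvd.mp this

/-- On `Y² = X (X² + A X + B)` the square class of `X` is represented by a divisor of any `D` that is
divisible by all primes dividing `B`. -/
theorem exists_dvd_mul_sq {A B D : ℤ} {X Y : ℚ} (hX : X ≠ 0)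
    (hBD : ∀ q : ℤ, Prime q → q ∣ B → q ∣ D) (h : Y ^ 2 = X * (X ^ 2 + A * X + B)) :
    ∃ (b : ℤ) (r : ℚ), b ∣ D ∧ r ≠ 0 ∧ X = b * r ^ 2 := by
  obtain ⟨b, r, hb, hr, hXb⟩ := Rat.exists_squarefree_mul_sq hX
  obtain ⟨M, e, n, hMe, hn⟩ := exists_int_sq_eq_of_sq_class hr hXb h
  exact ⟨b, r, Int.dvd_of_squarefree_of_forall_prime hb fun q hq hqb ↦
    hBD q hq (hq.dvd_of_sq_eq_squarefree_mul hb hqb hMe hn), hr, hXb⟩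

/-! ### Local obstructions -/

theorem Int.sq_emod_eight_of_odd {n : ℤ} (h : n % 2 = 1) : n ^ 2 % 8 = 1 := by
  rw [sq]
  have : n % 8 = 1 ∨ n % 8 = 3 ∨ n % 8 = 5 ∨ n % 8 = 7 := by omega
  rcases this with h | h | h | h <;> simp [Int.mul_emod, h]

theorem Int.sq_emod_eight (n : ℤ) : n ^ 2 % 8 = 0 ∨ n ^ 2 % 8 = 1 ∨ n ^ 2 % 8 = 4 := by
  rw [sq]
  have : n % 8 = 0 ∨ n % 8 = 1 ∨ n % 8 = 2 ∨ n % 8 = 3 ∨ n % 8 = 4 ∨ n % 8 = 5 ∨ n % 8 = 6 ∨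
    n % 8 = 7 := by omega
  rcases this with h | h | h | h | h | h | h | h <;> simp [Int.mul_emod, h]

/-- The quartic is not soluble over `ℚ₂`. Only the residues modulo `8` matter, after removing the
common powers of `4` in the cases `2 ∣ M` and `4 ∣ M`. -/
theorem two_adic_obstruction {k A c M e n : ℤ} (hk : k % 8 = 3) (hA : A % 8 = 5) (hc : c % 8 = 1)
    (hMe : IsCoprime M e) (h : n ^ 2 = k * (M ^ 4 + A * M ^ 2 * e ^ 2 + 32 * c * e ^ 4)) :
    False := by
  -- Every case ends with `n ^ 2 = k * g` in which `k * g` is not a square modulo `8`.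
  have key (n g : ℤ) (hng : n ^ 2 = k * g)
      (hg : g % 8 = 1 ∨ g % 8 = 2 ∨ g % 8 = 5 ∨ g % 8 = 6 ∨ g % 8 = 7) : False := by
    have h1 := Int.sq_emod_eight n
    rw [hng, Int.mul_emod, hk] at h1
    rcases hg with h | h | h | h | h <;> simp [h] at h1
  have halve (n g : ℤ) (hng : n ^ 2 = k * (4 * g)) : ∃ n', n' ^ 2 = k * g := by
    obtain ⟨n', rfl⟩ : (2 : ℤ) ∣ n := Int.prime_two.dvd_of_dvd_pow (n := 2) ⟨2 * k * g, by
      rw [hng]; ring⟩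
    exact ⟨n', by linarith⟩
  have hodd : M % 2 = 1 ∨ e % 2 = 1 := by
    by_contra! hne
    have h2 : IsUnit (2 : ℤ) := hMe.isUnit_of_dvd' (by omega) (by omega)
    exact absurd h2 (by decide)
  have h4 (x : ℤ) (hx : x % 2 = 1) : x ^ 4 % 8 = 1 := by
    rw [show x ^ 4 = (x ^ 2) ^ 2 by ring]
    exact Int.sq_emod_eight_of_odd (by have := Int.sq_emod_eight_of_odd hx; omega)
  have hmul (x y : ℤ) : A * x * y % 8 = 5 * (x % 8) * (y % 8) % 8 := by
    rw [Int.mul_emod, Int.mul_emod A, hA]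
    simp [Int.mul_emod]
  rcases Int.emod_two_eq_zero_or_one M with hM | hM
  · have he := hodd.resolve_left (by omega)
    have he2 := Int.sq_emod_eight_of_odd he
    have he4 := h4 e he
    have hce : c * e ^ 4 % 8 = 1 := by rw [Int.mul_emod, hc, he4]; rfl
    obtain ⟨m, rfl⟩ := Int.dvd_of_emod_eq_zero hM
    obtain ⟨n₁, h₁⟩ := halve n (4 * m ^ 4 + A * m ^ 2 * e ^ 2 + 8 * (c * e ^ 4)) (by rw [h]; ring)
    rcases Int.emod_two_eq_zero_or_one m with hm | hm
    · obtain ⟨l, rfl⟩ := Int.dvd_of_emod_eq_zero hm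
      obtain ⟨n₂, h₂⟩ := halve n₁ (16 * l ^ 4 + A * l ^ 2 * e ^ 2 + 2 * (c * e ^ 4))
        (by rw [h₁]; ring)
      refine key _ _ h₂ ?_
      have h5 := hmul (l ^ 2) (e ^ 2)
      rw [he2] at h5
      rcases Int.sq_emod_eight l with hl | hl | hl <;> rw [hl] at h5 <;> omega
    · refine key _ _ h₁ ?_
      have h5 := hmul (m ^ 2) (e ^ 2)
      rw [he2, Int.sq_emod_eight_of_odd hm] at h5
      have := h4 m hm
      omega
  · refine key _ _ h ?_
    have h5 := hmul (M ^ 2) (e ^ 2)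
    have hM4 := h4 M hM
    rw [Int.sq_emod_eight_of_odd hM] at h5
    have h6 : 32 * c * e ^ 4 = 8 * (4 * c * e ^ 4) := by ring
    rcases Int.sq_emod_eight e with he | he | he <;> rw [he] at h5 <;> omega

/-- Modulo `7` the quartic is `(M² + 2 c e²)²`, and `-2 c` is not a square. -/
theorem mod_seven_obstruction {c M e : ℤ} (hc : c % 7 = 1 ∨ c % 7 = 2 ∨ c % 7 = 4)
    (hMe : IsCoprime M e) : ¬ (7 : ℤ) ∣ M ^ 4 + 11 * c * M ^ 2 * e ^ 2 + 32 * c ^ 2 * e ^ 4 := by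
  intro h
  have h0 := (ZMod.intCast_zmod_eq_zero_iff_dvd _ 7).mpr h
  push_cast at h0
  have hc' : (c : ZMod 7) = 1 ∨ (c : ZMod 7) = 2 ∨ (c : ZMod 7) = 4 := by
    have := ZMod.intCast_mod c 7
    rcases hc with h | h | h <;> rw [← this, show ((7 : ℕ) : ℤ) = 7 from rfl, h] <;> simp
  have key : ∀ c M e : ZMod 7, (c = 1 ∨ c = 2 ∨ c = 4) →
      M ^ 4 + 11 * c * M ^ 2 * e ^ 2 + 32 * c ^ 2 * e ^ 4 = 0 → M = 0 ∧ e = 0 := by decide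
  obtain ⟨hM, he⟩ := key _ _ _ hc' h0
  have h7 : IsUnit (7 : ℤ) := hMe.isUnit_of_dvd' ((ZMod.intCast_zmod_eq_zero_iff_dvd _ 7).mp hM)
    ((ZMod.intCast_zmod_eq_zero_iff_dvd _ 7).mp he)
  exact absurd h7 (by decide)

/-- If `c` is not a square modulo `p` then `x² = c y²` has only the trivial solution modulo `p`. -/
theorem Int.dvd_of_dvd_sq_sub_nonsquare_mul_sq {p : ℕ} [Fact p.Prime] {c x y : ℤ}
    (hc : ¬ IsSquare (c : ZMod p)) (h : (p : ℤ) ∣ x ^ 2 - c * y ^ 2) :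
    (p : ℤ) ∣ x ∧ (p : ℤ) ∣ y := by
  simp only [← ZMod.intCast_zmod_eq_zero_iff_dvd] at h ⊢
  push_cast at h
  have hy : (y : ZMod p) = 0 := by
    by_contra hy
    refine hc ⟨x / y, ?_⟩
    field_simp
    linear_combination -h
  exact ⟨by simpa [hy] using h, hy⟩

/-- Since `-1` is not a square modulo `p`, both `n` and `M` are divisible by `p`; after division the
equation reads `n² ≡ 7 (c e²)²` modulo `p`, and `7` is not a square either. -/
theorem neg_one_class_obstruction {p : ℕ} [hp : Fact p.Prime] {a c M e n : ℤ}
    (h₁ : ¬ IsSquare ((-1 : ℤ) : ZMod p)) (h₇ : ¬ IsSquare ((7 : ℤ) : ZMod p))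
    (hc : ¬ (p : ℤ) ∣ c) (hMe : IsCoprime M e)
    (h : n ^ 2 = -M ^ 4 + a * p * M ^ 2 * e ^ 2 + 7 * c ^ 2 * p ^ 2 * e ^ 4) : False := by
  have hpp : Prime (p : ℤ) := Nat.prime_iff_prime_int.mp hp.out
  obtain ⟨hn, hM⟩ := Int.dvd_of_dvd_sq_sub_nonsquare_mul_sq (x := n) (y := M ^ 2) h₁
    ⟨a * M ^ 2 * e ^ 2 + 7 * c ^ 2 * p * e ^ 4, by rw [h]; ring⟩
  obtain ⟨n, rfl⟩ := hn
  obtain ⟨m, rfl⟩ := hpp.dvd_of_dvd_pow hM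
  obtain ⟨-, he⟩ := Int.dvd_of_dvd_sq_sub_nonsquare_mul_sq (x := n) (y := c * e ^ 2) h₇
    ⟨-p * m ^ 4 + a * m ^ 2 * e ^ 2, mul_left_cancel₀ (pow_ne_zero 2 hpp.ne_zero)
      (by linear_combination h)⟩
  have := hpp.dvd_of_dvd_pow ((hpp.dvd_or_dvd he).resolve_left hc)
  exact hpp.not_isUnit (hMe.isUnit_of_dvd' (dvd_mul_right _ m) this)

/-- Completing the square, the quartic is `(M² + a e²)² - 2 (s e²)²`. -/
theorem nonsquare_two_obstruction {p : ℕ} [hp : Fact p.Prime] {a b s M e : ℤ}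
    (h₂ : ¬ IsSquare ((2 : ℤ) : ZMod p)) (hs : ¬ (p : ℤ) ∣ s) (hab : a ^ 2 - b = 2 * s ^ 2)
    (hMe : IsCoprime M e) : ¬ (p : ℤ) ∣ M ^ 4 + 2 * a * M ^ 2 * e ^ 2 + b * e ^ 4 := by
  intro h
  have hpp : Prime (p : ℤ) := Nat.prime_iff_prime_int.mp hp.out
  obtain ⟨hM, he⟩ := Int.dvd_of_dvd_sq_sub_nonsquare_mul_sq (x := M ^ 2 + a * e ^ 2)
    (y := s * e ^ 2) h₂ (by convert h using 1; linear_combination e ^ 4 * hab)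
  have he' := hpp.dvd_of_dvd_pow ((hpp.dvd_or_dvd he).resolve_left hs)
  have hM' : (p : ℤ) ∣ M ^ 2 := by
    have h3 := dvd_sub hM ((dvd_pow he' two_ne_zero).mul_left a)
    rwa [add_sub_cancel_right] at h3
  exact hpp.not_isUnit (hMe.isUnit_of_dvd' (hpp.dvd_of_dvd_pow hM') he')

/-! ### The square classes for the twists by `p` and `-7p` -/

/-- The equation of the twist of `X₁(14)` by `d`, in the coordinates `X = 4 (x + d)`, `Y = 8 y`,
which put its rational `2`-torsion point at the origin. -/
def OnTwist (d : ℤ) (X Y : ℚ) : Prop :=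
  Y ^ 2 = X * (X ^ 2 + (-11 * d : ℤ) * X + (32 * d ^ 2 : ℤ))

/-- The equation of the quotient of the curve `OnTwist d` by its rational `2`-torsion point. -/
def OnIsogenousTwist (d : ℤ) (X Y : ℚ) : Prop :=
  Y ^ 2 = X * (X ^ 2 + (22 * d : ℤ) * X + (-7 * d ^ 2 : ℤ))

/-- Translation by the `2`-torsion point `(0, 0)` replaces `X` by `B / X`. -/
theorem sq_eq_of_div_self {A B X Y : ℚ} (hX : X ≠ 0)
    (h : Y ^ 2 = X * (X ^ 2 + A * X + B)) :
    (B * Y / X ^ 2) ^ 2 = B / X * ((B / X) ^ 2 + A * (B / X) + B) := by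
  field_simp
  rw [h]
  ring

/-- The quadratic factor has discriminant `-7 d²`, so it is positive. -/
theorem OnTwist.pos {d : ℤ} {X Y : ℚ} (hd : d ≠ 0) (hX : X ≠ 0) (h : OnTwist d X Y) : 0 < X := by
  have hd' : (d : ℚ) ≠ 0 := Int.cast_ne_zero.mpr hd
  have hq : 0 < X ^ 2 + (-11 * d : ℤ) * X + (32 * d ^ 2 : ℤ) := by
    push_cast
    have : 0 < (d : ℚ) ^ 2 := by positivity
    nlinarith [sq_nonneg (2 * X - 11 * d)]
  rw [OnTwist] at h
  by_contra! hneg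
  have : X < 0 := lt_of_le_of_ne hneg hX
  nlinarith [sq_nonneg Y]

theorem Int.dvd_mul_prime {b m : ℤ} {p : ℕ} (hp : p.Prime) (h : b ∣ m * p) :
    ∃ c, c ∣ m ∧ (b = c ∨ b = c * p) := by
  obtain ⟨c, q, hc, hq, rfl⟩ := exists_dvd_and_dvd_of_dvd_mul h
  have hq' : q.natAbs = 1 ∨ q.natAbs = p := (Nat.dvd_prime hp).mp (Int.natAbs_dvd_natAbs.mpr hq)
  rcases hq' with h | h <;> rcases Int.natAbs_eq q with h' | h' <;> rw [h] at h' <;> subst h'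
  · exact ⟨c, hc, .inl (by simp)⟩
  · exact ⟨-c, (neg_dvd).mpr hc, .inl (by simp)⟩
  · exact ⟨c, hc, .inr rfl⟩
  · exact ⟨-c, (neg_dvd).mpr hc, .inr (by ring)⟩

/-- A prime `p ≡ 3 (mod 8)` that is a square modulo `7`, the latter condition being spelled out in
terms of residues. -/
structure TwistPrime (p : ℕ) : Prop where
  prime : p.Prime
  mod_eight : p % 8 = 3
  mod_seven : p % 7 = 1 ∨ p % 7 = 2 ∨ p % 7 = 4

namespace TwistPrime

variable {p : ℕ}

theorem of_legendreSym (hp : p.Prime) (h8 : p ≡ 3 [MOD 8]) (h7 : legendreSym 7 (p : ℤ) = 1) :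
    TwistPrime p := by
  refine ⟨hp, h8, ?_⟩
  have h0 : ((p : ℤ) : ZMod 7) ≠ 0 := fun h ↦ by
    rw [(legendreSym.eq_zero_iff 7 _).mpr h] at h7
    exact absurd h7 (by decide)
  rw [legendreSym.eq_one_iff 7 h0] at h7
  have key : ∀ x : ZMod 7, x ≠ 0 → IsSquare x → x.val = 1 ∨ x.val = 2 ∨ x.val = 4 := by decide
  have := key _ h0 h7
  rwa [Int.cast_natCast, ZMod.val_natCast] at this

theorem not_isSquare_neg_one (h : TwistPrime p) [Fact p.Prime] :
    ¬ IsSquare ((-1 : ℤ) : ZMod p) := by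
  have := h.mod_eight
  push_cast
  rw [ZMod.exists_sq_eq_neg_one_iff]
  omega

theorem not_isSquare_two (h : TwistPrime p) [Fact p.Prime] : ¬ IsSquare ((2 : ℤ) : ZMod p) := by
  have := h.mod_eight
  push_cast
  rw [ZMod.exists_sq_eq_two_iff (by omega)]
  omega

theorem not_isSquare_seven (h : TwistPrime p) [Fact p.Prime] : ¬ IsSquare ((7 : ℤ) : ZMod p) := by
  have h8 := h.mod_eight
  have h7 := h.mod_seven
  have h0 : ((p : ℤ) : ZMod 7) ≠ 0 := by
    rw [Int.cast_natCast, Ne, ZMod.natCast_eq_zero_iff]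
    omega
  have h1 : legendreSym 7 p = 1 := by
    rw [legendreSym.eq_one_iff 7 h0, Int.cast_natCast, ← ZMod.natCast_mod]
    rcases h7 with h | h | h <;> rw [h] <;> decide
  have h2 := legendreSym.quadratic_reciprocity_three_mod_four (p := p) (q := 7) (by omega) rfl
  rw [h1] at h2
  have h3 : legendreSym p 7 = -1 := by
    have : ((7 : ℕ) : ℤ) = 7 := rfl
    rw [this] at h2
    linarith
  exact (legendreSym.eq_neg_one_iff p).mp h3

theorem prime_int (h : TwistPrime p) : Prime (p : ℤ) := Nat.prime_iff_prime_int.mp h.prime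

theorem not_dvd {k : ℤ} (h : TwistPrime p) (hk : k ∣ 56) : ¬ (p : ℤ) ∣ k := fun hpk ↦ by
  have h56 : p ∣ 2 ^ 3 * 7 := by
    have := hpk.trans hk
    rwa [show (56 : ℤ) = ((2 ^ 3 * 7 : ℕ) : ℤ) from rfl, Int.natCast_dvd_natCast] at this
  have h8 := h.mod_eight
  have h7 := h.mod_seven
  rcases (Nat.Prime.dvd_mul h.prime).mp h56 with h2 | h2
  · rw [(Nat.prime_dvd_prime_iff_eq h.prime Nat.prime_two).mp (h.prime.dvd_of_dvd_pow h2)] at h8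
    omega
  · rw [(Nat.prime_dvd_prime_iff_eq h.prime (by norm_num)).mp h2] at h7
    omega

end TwistPrime

/-- If the square class `b` does not occur on the twist then neither does `2 b`, because `2` is the
class of the `2`-torsion point `(0, 0)`. -/
theorem OnTwist.of_two_mul_class {d b : ℤ} (hd : d ≠ 0)
    (H : ∀ X Y r : ℚ, r ≠ 0 → X = b * r ^ 2 → ¬ OnTwist d X Y)
    (X Y r : ℚ) (hr : r ≠ 0) (hb : b ≠ 0) (hX : X = (2 * b : ℤ) * r ^ 2) : ¬ OnTwist d X Y := by
  intro h
  have hd' : (d : ℚ) ≠ 0 := Int.cast_ne_zero.mpr hd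
  have hb' : (b : ℚ) ≠ 0 := Int.cast_ne_zero.mpr hb
  have hX0 : X ≠ 0 := by rw [hX]; push_cast; positivity
  refine H _ _ (4 * d / (b * r)) (by positivity) ?_ (sq_eq_of_div_self hX0 h)
  rw [hX]
  push_cast
  field_simp
  norm_num

/-- The positive square classes supported at the primes dividing `D p`, sorted by whether `p`
occurs. -/
theorem OnTwist.exists_class {d D : ℤ} {p : ℕ} (hp : p.Prime) (hd : d ≠ 0)
    (hD : 32 * d ^ 2 ∣ (D * p) ^ 5) {X Y : ℚ} (hX : X ≠ 0) (h : OnTwist d X Y) :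
    ∃ (c : ℕ) (r : ℚ), (c : ℤ) ∣ D ∧ 0 < c ∧ r ≠ 0 ∧
      (X = (c : ℤ) * r ^ 2 ∨ X = (c * p : ℤ) * r ^ 2) := by
  have hpos := h.pos hd hX
  obtain ⟨b, r, hb, hr, hXb⟩ := exists_dvd_mul_sq (D := D * p) hX
    (fun q hq h ↦ hq.dvd_of_dvd_pow (h.trans hD)) h
  have hb0 : 0 < b := by
    by_contra! hb
    have : (b : ℚ) ≤ 0 := by exact_mod_cast hb
    rw [hXb] at hpos
    nlinarith [sq_nonneg r]
  obtain ⟨c, hc, hbc⟩ := Int.dvd_mul_prime hp hb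
  have hp0 : 0 < (p : ℤ) := by exact_mod_cast hp.pos
  have hc0 : 0 < c := by
    rcases hbc with h | h
    · omega
    · rw [h] at hb0
      exact (mul_pos_iff_of_pos_right hp0).mp hb0
  lift c to ℕ using hc0.le
  refine ⟨c, r, hc, by exact_mod_cast hc0, hr, ?_⟩
  rcases hbc with rfl | rfl
  · exact .inl hXb
  · exact .inr (by exact_mod_cast hXb)

theorem Int.pow_three_emod_eight {k : ℤ} (hk : k % 8 = 3) : k ^ 3 % 8 = 3 := by
  rw [pow_succ, sq, Int.mul_emod, Int.mul_emod k, hk]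
  rfl

theorem TwistPrime.sq_class_of_onTwist {p : ℕ} (hp : TwistPrime p) {X Y : ℚ} (hX : X ≠ 0)
    (h : OnTwist p X Y) : ∃ r : ℚ, X = r ^ 2 ∨ X = 2 * r ^ 2 := by
  have hp0 : (p : ℤ) ≠ 0 := hp.prime_int.ne_zero
  have hobs : ∀ X Y r : ℚ, r ≠ 0 → X = (p : ℤ) * r ^ 2 → ¬ OnTwist p X Y := by
    intro X Y r hr hX h
    obtain ⟨M, e, n, hMe, hn⟩ := exists_int_sq_eq_of_sq_class hr hX h
    have h8 := hp.mod_eight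
    exact two_adic_obstruction (k := p ^ 3) (A := -11) (c := 1) (n := n)
      (Int.pow_three_emod_eight (by omega)) rfl rfl hMe (by rw [hn]; ring)
  obtain ⟨c, r, hc, hc0, hr, hXc⟩ := h.exists_class (D := 2) hp.prime hp0
    ⟨(p : ℤ) ^ 3, by ring⟩ hX
  have hc' : c = 1 ∨ c = 2 := (Nat.dvd_prime Nat.prime_two).mp (by exact_mod_cast hc)
  rcases hc' with rfl | rfl <;> rcases hXc with rfl | hXc
  · exact ⟨r, .inl (by simp)⟩
  · exact absurd h (hobs X Y r hr (by simpa using hXc))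
  · exact ⟨r, .inr (by simp)⟩
  · exact absurd h (OnTwist.of_two_mul_class hp0 hobs X Y r hr hp0 (by simpa using hXc))

theorem TwistPrime.sq_class_of_onTwist_neg_seven_mul {p : ℕ} (hp : TwistPrime p) {X Y : ℚ}
    (hX : X ≠ 0) (h : OnTwist (-7 * p) X Y) : ∃ r : ℚ, X = r ^ 2 ∨ X = 2 * r ^ 2 := by
  have hp0 : (p : ℤ) ≠ 0 := hp.prime_int.ne_zero
  have hd0 : -7 * (p : ℤ) ≠ 0 := by omega
  have h8 := hp.mod_eight
  have hmod := hp.mod_seven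
  have h7p : Prime (7 : ℤ) := Int.prime_ofNat_iff.mpr (by norm_num)
  have hp7 : ¬ (7 : ℤ) ∣ p := by omega
  have hobs : ∀ X Y r : ℚ, r ≠ 0 → X = (p : ℤ) * r ^ 2 → ¬ OnTwist (-7 * p) X Y := by
    intro X Y r hr hX h
    obtain ⟨M, e, n, hMe, hn⟩ := exists_int_sq_eq_of_sq_class hr hX h
    exact two_adic_obstruction (k := p ^ 3) (A := 77) (c := 49) (n := n)
      (Int.pow_three_emod_eight (by omega)) rfl rfl hMe (by rw [hn]; ring)
  have hobs' : ∀ X Y r : ℚ, r ≠ 0 → X = (7 : ℤ) * r ^ 2 → ¬ OnTwist (-7 * p) X Y := by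
    intro X Y r hr hX h
    obtain ⟨M, e, n, hMe, hn⟩ := exists_int_sq_eq_of_sq_class hr hX h
    obtain ⟨n, rfl⟩ : (7 : ℤ) ∣ n := h7p.dvd_of_dvd_pow (n := 2) ⟨_, by rw [hn, mul_assoc]⟩
    obtain ⟨n, rfl⟩ : (7 : ℤ) ∣ n := h7p.dvd_of_dvd_pow (n := 2)
      ⟨M ^ 4 + 11 * p * M ^ 2 * e ^ 2 + 32 * p ^ 2 * e ^ 4, by linarith⟩
    exact mod_seven_obstruction (c := p) (by omega) hMe ⟨n ^ 2, by linarith⟩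
  have hobs'' : ∀ X Y r : ℚ, r ≠ 0 → X = (7 * p : ℤ) * r ^ 2 → ¬ OnTwist (-7 * p) X Y := by
    intro X Y r hr hX h
    obtain ⟨M, e, n, hMe, hn⟩ := exists_int_sq_eq_of_sq_class (b := 7 * p) hr
      (by exact_mod_cast hX) h
    obtain ⟨n, rfl⟩ : (7 : ℤ) ∣ n := h7p.dvd_of_dvd_pow (n := 2)
      ⟨_, by rw [hn, mul_assoc, mul_assoc]⟩
    obtain ⟨n, rfl⟩ : (7 : ℤ) ∣ n := h7p.dvd_of_dvd_pow (n := 2)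
      ⟨p ^ 3 * (M ^ 4 + 11 * M ^ 2 * e ^ 2 + 32 * e ^ 4), by linarith⟩
    have h7 : (7 : ℤ) ∣ p ^ 3 * (M ^ 4 + 11 * 1 * M ^ 2 * e ^ 2 + 32 * 1 ^ 2 * e ^ 4) :=
      ⟨n ^ 2, by linarith⟩
    refine mod_seven_obstruction (c := 1) (.inl rfl) hMe ((h7p.dvd_or_dvd h7).resolve_left ?_)
    exact fun h ↦ hp7 (h7p.dvd_of_dvd_pow h)
  obtain ⟨c, r, hc, hc0, hr, hXc⟩ := h.exists_class (D := 14) hp.prime hd0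
    ⟨343 * (p : ℤ) ^ 3, by ring⟩ hX
  have hc' : c ∈ Nat.divisors 14 := Nat.mem_divisors.mpr ⟨by exact_mod_cast hc, by norm_num⟩
  have hdiv : Nat.divisors 14 = {1, 2, 7, 14} := by decide
  simp only [hdiv, Finset.mem_insert, Finset.mem_singleton] at hc'
  rcases hc' with rfl | rfl | rfl | rfl <;> rcases hXc with rfl | hXc
  · exact ⟨r, .inl (by simp)⟩
  · exact absurd h (hobs X Y r hr (by simpa using hXc))
  · exact ⟨r, .inr (by simp)⟩
  · exact absurd h (OnTwist.of_two_mul_class hd0 hobs X Y r hr hp0 (by simpa using hXc))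
  · exact absurd h (hobs' _ Y r hr (by simp))
  · exact absurd h (hobs'' X Y r hr (by simpa using hXc))
  · exact absurd h (OnTwist.of_two_mul_class hd0 hobs' _ Y r hr (by norm_num) (by norm_num))
  · refine absurd h (OnTwist.of_two_mul_class (b := 7 * p) hd0 ?_ X Y r hr (by omega) ?_)
    · exact fun X Y r hr hX ↦ hobs'' X Y r hr (by simpa using hX)
    · rw [hXc]
      push_cast
      ring

/-- The square classes on the isogenous curve for `d = p` (`ε = 1`, `c = 1`) and `d = -7 p`
(`ε = -1`, `c = 7`). The class of `(0, 0)` is `-7`, so it suffices to exclude `-1` and `±p`. -/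
theorem TwistPrime.sq_class_of_onIsogenousTwist {p : ℕ} (hp : TwistPrime p) {ε c : ℤ}
    (hc : ε = 1 ∧ c = 1 ∨ ε = -1 ∧ c = 7) {X Y : ℚ} (hX : X ≠ 0)
    (h : OnIsogenousTwist (ε * c * p) X Y) : ∃ r : ℚ, X = r ^ 2 ∨ X = -7 * r ^ 2 := by
  have : Fact p.Prime := ⟨hp.prime⟩
  have hpi := hp.prime_int
  have hp0 : (p : ℤ) ≠ 0 := hpi.ne_zero
  have hc56 : 8 * c ∣ 56 := by rcases hc with ⟨-, rfl⟩ | ⟨-, rfl⟩ <;> decide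
  have hc2 : c ^ 2 = 1 ∨ c ^ 2 = 49 := by rcases hc with ⟨-, rfl⟩ | ⟨-, rfl⟩ <;> decide
  have hε : ε ^ 2 = 1 := by rcases hc with ⟨rfl, -⟩ | ⟨rfl, -⟩ <;> rfl
  have hc0 : c ≠ 0 := by rintro rfl; simp at hc2
  have hobs₁ : ∀ X Y r : ℚ, r ≠ 0 → X = (-1 : ℤ) * r ^ 2 →
      ¬ OnIsogenousTwist (ε * c * p) X Y := by
    intro X Y r hr hX h
    obtain ⟨M, e, n, hMe, hn⟩ := exists_int_sq_eq_of_sq_class hr hX h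
    refine neg_one_class_obstruction (a := 22 * ε * c) (c := c) (n := n) hp.not_isSquare_neg_one
      hp.not_isSquare_seven (hp.not_dvd ((dvd_mul_left c 8).trans hc56)) hMe ?_
    rw [hn]
    linear_combination 7 * c ^ 2 * p ^ 2 * e ^ 4 * hε
  have hobs₂ (δ : ℤ) (hδ : δ ^ 2 = 1) : ∀ X Y r : ℚ, r ≠ 0 → X = (δ * p : ℤ) * r ^ 2 →
      ¬ OnIsogenousTwist (ε * c * p) X Y := by
    intro X Y r hr hX h
    obtain ⟨M, e, n, hMe, hn⟩ := exists_int_sq_eq_of_sq_class hr hX h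
    obtain ⟨n, rfl⟩ : (p : ℤ) ∣ n := hpi.dvd_of_dvd_pow (n := 2)
      ⟨δ * ((δ * p) ^ 2 * M ^ 4 + (22 * (ε * c * p)) * (δ * p) * M ^ 2 * e ^ 2 +
        (-7 * (ε * c * p) ^ 2) * e ^ 4), by rw [hn]; ring⟩
    obtain ⟨n, rfl⟩ : (p : ℤ) ∣ n := hpi.dvd_of_dvd_pow (n := 2)
      ⟨δ * (M ^ 4 * δ ^ 2 + 2 * (11 * ε * c * δ) * M ^ 2 * e ^ 2 + (-7 * c ^ 2 * ε ^ 2) * e ^ 4),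
        mul_left_cancel₀ (pow_ne_zero 2 hp0) (by linear_combination hn)⟩
    refine nonsquare_two_obstruction (a := 11 * ε * c * δ) (b := -7 * c ^ 2) (s := 8 * c)
      hp.not_isSquare_two (hp.not_dvd hc56) ?_ hMe ⟨n ^ 2 * δ, ?_⟩
    · linear_combination 121 * c ^ 2 * δ ^ 2 * hε + 121 * c ^ 2 * hδ
    · refine mul_left_cancel₀ (pow_ne_zero 3 hp0) ?_
      linear_combination -δ * hn - (p ^ 3 * M ^ 4 * (δ ^ 2 + 1) +
        22 * p ^ 3 * ε * c * δ * M ^ 2 * e ^ 2 - 7 * c ^ 2 * e ^ 4 * p ^ 3 * ε ^ 2) * hδ +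
        7 * c ^ 2 * e ^ 4 * p ^ 3 * hε
  have hneg (b : ℤ) (hb : b ≠ 0) (H : ∀ X Y r : ℚ, r ≠ 0 → X = b * r ^ 2 →
      ¬ OnIsogenousTwist (ε * c * p) X Y) (X Y r : ℚ) (hr : r ≠ 0)
      (hX : X = (-7 * b : ℤ) * r ^ 2) : ¬ OnIsogenousTwist (ε * c * p) X Y := by
    intro h
    have hb' : (b : ℚ) ≠ 0 := Int.cast_ne_zero.mpr hb
    have hd' : ((ε * c * p : ℤ) : ℚ) ≠ 0 := Int.cast_ne_zero.mpr
      (mul_ne_zero (mul_ne_zero (by rintro rfl; simp at hε) hc0) hp0)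
    have hX0 : X ≠ 0 := by rw [hX]; push_cast; positivity
    refine H _ _ ((ε * c * p : ℤ) / (b * r)) (by positivity) ?_ (sq_eq_of_div_self hX0 h)
    rw [hX]
    push_cast
    field_simp
  have hB : -7 * (ε * c * p) ^ 2 ∣ (7 * p : ℤ) ^ 4 := by
    rcases hc with ⟨rfl, rfl⟩ | ⟨rfl, rfl⟩
    · exact ⟨-343 * p ^ 2, by ring⟩
    · exact ⟨-7 * p ^ 2, by ring⟩
  obtain ⟨b, r, hb, hr, hXb⟩ := exists_dvd_mul_sq (D := 7 * p) hX
    (fun q hq h ↦ hq.dvd_of_dvd_pow (h.trans hB)) h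
  obtain ⟨k, hk, hbk⟩ := Int.dvd_mul_prime hp.prime hb
  have hk' : k.natAbs = 1 ∨ k.natAbs = 7 := (Nat.dvd_prime (by norm_num)).mp
    (Int.natAbs_dvd_natAbs.mpr hk)
  have hk'' : k = 1 ∨ k = -1 ∨ k = 7 ∨ k = -7 := by omega
  rcases hk'' with rfl | rfl | rfl | rfl <;> rcases hbk with rfl | rfl
  · exact ⟨r, .inl (by simp [hXb])⟩
  · exact absurd h (hobs₂ 1 rfl X Y r hr hXb)
  · exact absurd h (hobs₁ X Y r hr hXb)
  · exact absurd h (hobs₂ (-1) rfl X Y r hr hXb)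
  · exact absurd h (hneg (-1) (by decide) hobs₁ X Y r hr hXb)
  · exact absurd h (hneg (-1 * p) (by simpa using hp0) (hobs₂ (-1) rfl) X Y r hr (by
      rw [hXb]; push_cast; ring))
  · exact ⟨r, .inr (by simp [hXb])⟩
  · exact absurd h (hneg (1 * p) (by simpa using hp0) (hobs₂ 1 rfl) X Y r hr (by
      rw [hXb]; push_cast; ring))

/-! ### Explicit chords and tangents -/

namespace WeierstrassCurve.Affine.Point

variable {F : Type*} [Field F] [DecidableEq F] {W : WeierstrassCurve.Affine F}

/-- The chord construction with a prescribed slope `ℓ`. -/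
theorem some_add_some_eq {x₁ y₁ x₂ y₂ x₃ y₃ : F} {h₁ : W.Nonsingular x₁ y₁}
    {h₂ : W.Nonsingular x₂ y₂} (h₃ : W.Nonsingular x₃ y₃) (hx : x₁ ≠ x₂) (ℓ : F)
    (hℓ : ℓ * (x₁ - x₂) = y₁ - y₂) (hX : W.addX x₁ x₂ ℓ = x₃)
    (hY : W.negY x₃ (ℓ * (x₃ - x₁) + y₁) = y₃) :
    some x₁ y₁ h₁ + some x₂ y₂ h₂ = some x₃ y₃ h₃ := by
  have hs : W.slope x₁ x₂ y₁ y₂ = ℓ := by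
    rw [slope_of_X_ne hx, div_eq_iff (sub_ne_zero.mpr hx), hℓ]
  subst hX hY
  rw [add_of_X_ne hx]
  simp only [hs, addY, negAddY]

/-- The tangent construction with a prescribed slope `ℓ`. -/
theorem two_nsmul_some_eq {x₁ y₁ x₃ y₃ : F} {h₁ : W.Nonsingular x₁ y₁}
    (h₃ : W.Nonsingular x₃ y₃) (hy : y₁ ≠ W.negY x₁ y₁) (ℓ : F)
    (hℓ : ℓ * (y₁ - W.negY x₁ y₁) = 3 * x₁ ^ 2 + 2 * W.a₂ * x₁ + W.a₄ - W.a₁ * y₁)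
    (hX : W.addX x₁ x₁ ℓ = x₃) (hY : W.negY x₃ (ℓ * (x₃ - x₁) + y₁) = y₃) :
    2 • some x₁ y₁ h₁ = some x₃ y₃ h₃ := by
  have hs : W.slope x₁ x₁ y₁ y₁ = ℓ := by
    rw [slope_of_Y_ne rfl hy, div_eq_iff (sub_ne_zero.mpr hy), hℓ]
  subst hX hY
  rw [two_nsmul, add_self_of_Y_ne hy]
  simp only [hs, addY, negAddY]

end WeierstrassCurve.Affine.Point

/-! ### The `2`-descent on the twists -/

open WeierstrassCurve.Affine

theorem X1_14_quadraticTwist_equation_iff {d : ℤ} {x y : ℚ} :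
    (X1_14.quadraticTwist d).toAffine.Equation x y ↔ OnTwist d (4 * (x + d)) (8 * y) := by
  rw [equation_iff, OnTwist]
  simp only [WeierstrassCurve.quadraticTwist, X1_14, WeierstrassCurve.b₂, WeierstrassCurve.b₄,
    WeierstrassCurve.b₆]
  push_cast
  constructor <;> intro h
  · linear_combination 64 * h
  · linear_combination h / 64

theorem X1_14_quadraticTwist_isElliptic {d : ℤ} (hd : d ≠ 0) :
    (X1_14.quadraticTwist d).IsElliptic := by
  have hd' : (d : ℚ) ≠ 0 := Int.cast_ne_zero.mpr hd
  have hΔ : (X1_14.quadraticTwist d).Δ = -28 * (d : ℚ) ^ 6 := by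
    simp only [WeierstrassCurve.quadraticTwist, X1_14, WeierstrassCurve.b₂, WeierstrassCurve.b₄,
      WeierstrassCurve.b₆, WeierstrassCurve.b₈, WeierstrassCurve.Δ]
    ring
  exact ⟨by rw [hΔ]; exact (mul_ne_zero (by norm_num) (pow_ne_zero _ hd')).isUnit⟩

/-- The explicit half of a point. Here `w² = X` and `v²` is the `X`-coordinate of a preimage of
`(X, Y)` under the dual isogeny; then `u = (v² + 11 d) / 2 + w v` is the `X`-coordinate of a preimage
of that preimage, with ordinate `v u`, and the tangent there has slope `v + w`. -/
theorem exists_two_nsmul_eq_some {d : ℤ} (hd : d ≠ 0) {x y w v : ℚ} (hw : w ≠ 0) (hv : v ≠ 0)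
    (hxw : 4 * (x + d) = w ^ 2) (hvw : v ^ 2 = -11 * d + 2 * w ^ 2 + 2 * (8 * y / w))
    (h : (X1_14.quadraticTwist d).toAffine.Nonsingular x y) :
    ∃ R : (X1_14.quadraticTwist d).toAffine.Point, 2 • R = .some x y h := by
  have hE := X1_14_quadraticTwist_isElliptic hd
  have hd' : (d : ℚ) ≠ 0 := Int.cast_ne_zero.mpr hd
  have heq := X1_14_quadraticTwist_equation_iff.mp h.1
  rw [OnTwist, hxw] at heq
  obtain ⟨z, hz⟩ : ∃ z, z = 8 * y / w := ⟨_, rfl⟩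
  have hyz : 8 * y = w * z := by rw [hz]; field_simp
  rw [← hz] at hvw
  have hzz : z ^ 2 = w ^ 4 - 11 * d * w ^ 2 + 32 * d ^ 2 := by
    refine mul_left_cancel₀ (pow_ne_zero 2 hw) ?_
    rw [← mul_pow, ← hyz, heq]
    push_cast
    ring
  obtain ⟨u, hu⟩ : ∃ u, u = (v ^ 2 + 11 * d) / 2 + w * v := ⟨_, rfl⟩
  have huu : u ^ 2 - (v ^ 2 + 11 * d) * u + 32 * d ^ 2 = 0 := by
    rw [hu]
    linear_combination w ^ 2 * hvw - (v ^ 2 + 11 * d + 2 * w ^ 2 + 2 * z) / 4 * hvw - hzz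
  have hu0 : u ≠ 0 := by
    rintro rfl
    have : (32 : ℚ) * d ^ 2 ≠ 0 := by positivity
    exact this (by linear_combination huu)
  have hR : (X1_14.quadraticTwist d).toAffine.Equation (u / 4 - d) (v * u / 8) := by
    rw [X1_14_quadraticTwist_equation_iff, OnTwist]
    push_cast
    linear_combination -u * huu
  refine ⟨.some _ _ (equation_iff_nonsingular.mp hR), Point.two_nsmul_some_eq h ?_ ((v + w) / 2)
    ?_ ?_ ?_⟩
  · intro h0
    simp only [negY, WeierstrassCurve.quadraticTwist] at h0
    exact mul_ne_zero hv hu0 (by linear_combination 4 * h0)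
  all_goals simp only [negY, addX, WeierstrassCurve.quadraticTwist, X1_14, WeierstrassCurve.b₂,
    WeierstrassCurve.b₄]
  · linear_combination -huu / 16 - u / 8 * hu
  · linear_combination (-1 / 2) * hu - hxw / 4
  · linear_combination -(v + w) / 8 * hxw + w / 8 * hu + w / 16 * hvw - hyz / 8

/-- A point of the twist whose `X`-coordinate is a square is divisible by `2`. The two preimages under
the dual isogeny have `X`-coordinates with product `-7 d²`, so one of them is a square; passing from
one to the other amounts to replacing `w` by `-w`. -/
theorem exists_two_nsmul_eq_of_sq {d : ℤ} (hd : d ≠ 0)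
    (hβ : ∀ X Y : ℚ, X ≠ 0 → OnIsogenousTwist d X Y → ∃ r : ℚ, X = r ^ 2 ∨ X = -7 * r ^ 2)
    {x y w : ℚ} (hw : w ≠ 0) (hxw : 4 * (x + d) = w ^ 2)
    (h : (X1_14.quadraticTwist d).toAffine.Nonsingular x y) :
    ∃ R : (X1_14.quadraticTwist d).toAffine.Point, 2 • R = .some x y h := by
  have hd' : (d : ℚ) ≠ 0 := Int.cast_ne_zero.mpr hd
  have heq := X1_14_quadraticTwist_equation_iff.mp h.1
  rw [OnTwist, hxw] at heq
  have hz : (8 * y / w) ^ 2 = w ^ 4 - 11 * d * w ^ 2 + 32 * d ^ 2 := by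
    field_simp
    rw [← mul_pow, heq]
    push_cast
    ring
  -- The two candidates for the `X`-coordinate of a preimage under the dual isogeny.
  have hprod : (-11 * d + 2 * w ^ 2 + 2 * (8 * y / w)) * (-11 * d + 2 * w ^ 2 - 2 * (8 * y / w)) =
      -7 * (d : ℚ) ^ 2 := by
    linear_combination -4 * hz
  have hprod0 : -7 * (d : ℚ) ^ 2 ≠ 0 := mul_ne_zero (by norm_num) (pow_ne_zero 2 hd')
  obtain ⟨hne, hne'⟩ := mul_ne_zero_iff.mp (hprod ▸ hprod0)
  obtain ⟨v, hv | hv⟩ := hβ (-11 * d + 2 * w ^ 2 + 2 * (8 * y / w))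
    (2 * w * (-11 * d + 2 * w ^ 2 + 2 * (8 * y / w))) hne (by
      rw [OnIsogenousTwist]
      push_cast
      linear_combination -4 * (-11 * d + 2 * w ^ 2 + 2 * (8 * y / w)) * hz)
  · refine exists_two_nsmul_eq_some hd hw ?_ hxw hv.symm h
    rintro rfl
    exact hne (by simpa using hv)
  · have hv0 : v ≠ 0 := by
      rintro rfl
      exact hne (by simpa using hv)
    refine exists_two_nsmul_eq_some hd (neg_ne_zero.mpr hw) (div_ne_zero hd' hv0)
      (by simpa using hxw) ?_ h
    rw [hv] at hprod
    rw [div_neg, neg_sq, mul_neg, ← sub_eq_add_neg]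
    field_simp
    field_simp at hprod
    linear_combination hprod

theorem some_add_two_torsion_eq {d : ℤ} (hd : d ≠ 0) {x y : ℚ} (hx : x + d ≠ 0)
    (h : (X1_14.quadraticTwist d).toAffine.Nonsingular x y)
    (hT : (X1_14.quadraticTwist d).toAffine.Nonsingular (-d) 0) :
    ∃ h', Point.some x y h + Point.some (-d : ℚ) 0 hT =
      .some (2 * d ^ 2 / (x + d) - d) (-2 * d ^ 2 * y / (x + d) ^ 2) h' := by
  have hE := X1_14_quadraticTwist_isElliptic hd
  have heq := X1_14_quadraticTwist_equation_iff.mp h.1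
  have h' : (X1_14.quadraticTwist d).toAffine.Equation
      (2 * d ^ 2 / (x + d) - d) (-2 * d ^ 2 * y / (x + d) ^ 2) := by
    rw [X1_14_quadraticTwist_equation_iff, OnTwist]
    rw [OnTwist] at heq
    have := sq_eq_of_div_self (mul_ne_zero four_ne_zero hx) ((neg_sq _).trans heq)
    convert this using 2
    all_goals push_cast; field_simp; ring
  refine ⟨equation_iff_nonsingular.mp h', Point.some_add_some_eq _ ?_ (y / (x + d)) ?_ ?_ ?_⟩
  · exact fun h ↦ hx (by linear_combination h)
  · field_simp
    ring
  all_goals simp only [negY, addX, WeierstrassCurve.quadraticTwist, X1_14, WeierstrassCurve.b₂,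
    WeierstrassCurve.b₄]
  · rw [OnTwist] at heq
    push_cast at heq
    field_simp
    linear_combination heq / 16
  · field_simp
    ring

/-- If the square classes on both curves are those of the `2`-torsion points, the twist has
rank zero. -/
theorem rankQ_quadraticTwist_eq_zero {d : ℤ} (hd : d ≠ 0)
    (hα : ∀ X Y : ℚ, X ≠ 0 → OnTwist d X Y → ∃ r : ℚ, X = r ^ 2 ∨ X = 2 * r ^ 2)
    (hβ : ∀ X Y : ℚ, X ≠ 0 → OnIsogenousTwist d X Y → ∃ r : ℚ, X = r ^ 2 ∨ X = -7 * r ^ 2) :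
    (X1_14.quadraticTwist d).rankQ = 0 := by
  have hE := X1_14_quadraticTwist_isElliptic hd
  have hd' : (d : ℚ) ≠ 0 := Int.cast_ne_zero.mpr hd
  have hT : (X1_14.quadraticTwist d).toAffine.Nonsingular (-d) 0 := by
    rw [← equation_iff_nonsingular, X1_14_quadraticTwist_equation_iff, OnTwist]
    simp
  have hT2 : 2 • Point.some (-d : ℚ) 0 hT = 0 := by
    rw [two_nsmul, Point.add_self_of_Y_eq]
    simp [negY, WeierstrassCurve.quadraticTwist]
  refine WeierstrassCurve.rankQ_eq_zero_of_two_nsmul_eq_four_nsmul _ fun P ↦ ?_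
  suffices h : ∃ R : (X1_14.quadraticTwist d).toAffine.Point,
      2 • R = P ∨ 2 • R = P + Point.some (-d : ℚ) 0 hT by
    obtain ⟨R, hR | hR⟩ := h
    · exact ⟨R, by rw [← hR, ← mul_nsmul]⟩
    · refine ⟨R, ?_⟩
      rw [show 4 = 2 * 2 from rfl, mul_nsmul, hR, nsmul_add, hT2, add_zero]
  rcases P with _ | ⟨x, y, h⟩
  · exact ⟨0, .inl (nsmul_zero 2)⟩
  by_cases hx : x + d = 0
  · obtain rfl : x = -d := by linear_combination hx
    obtain rfl : y = 0 := by
      have := X1_14_quadraticTwist_equation_iff.mp h.1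
      simpa [OnTwist] using this
    exact ⟨0, .inr (by rw [nsmul_zero, ← two_nsmul, hT2])⟩
  obtain ⟨r, hr | hr⟩ := hα _ _ (mul_ne_zero four_ne_zero hx)
    (X1_14_quadraticTwist_equation_iff.mp h.1)
  · obtain ⟨R, hR⟩ := exists_two_nsmul_eq_of_sq hd hβ (w := r) (by
      rintro rfl
      exact hx (by linear_combination hr / 4)) hr h
    exact ⟨R, .inl hR⟩
  · have hr0 : r ≠ 0 := by
      rintro rfl
      exact hx (by linear_combination hr / 4)
    obtain ⟨h', hPT⟩ := some_add_two_torsion_eq hd hx h hT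
    obtain ⟨R, hR⟩ := exists_two_nsmul_eq_of_sq hd hβ (w := 4 * d / r) (by positivity) (by
      have : x + d = r ^ 2 / 2 := by linear_combination hr / 4
      rw [this]
      field_simp
      ring) h'
    exact ⟨R, .inr (hR.trans hPT.symm)⟩

theorem TwistPrime.rankQ_eq_zero {p : ℕ} (hp : TwistPrime p) :
    (X1_14.quadraticTwist (p : ℚ)).rankQ = 0 ∧
      (X1_14.quadraticTwist (-7 * (p : ℚ))).rankQ = 0 := by
  have hp0 := hp.prime_int.ne_zero
  constructor
  · have := rankQ_quadraticTwist_eq_zero hp0 (fun _ _ ↦ hp.sq_class_of_onTwist)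
      fun X Y hX h ↦ hp.sq_class_of_onIsogenousTwist (ε := 1) (c := 1) (.inl ⟨rfl, rfl⟩) hX
        (by simpa using h)
    simpa using this
  · have := rankQ_quadraticTwist_eq_zero (d := -7 * p) (by simpa using hp0)
      (fun _ _ ↦ hp.sq_class_of_onTwist_neg_seven_mul)
      fun X Y hX h ↦ hp.sq_class_of_onIsogenousTwist (ε := -1) (c := 7) (.inr ⟨rfl, rfl⟩) hX
        (by simpa using h)
    push_cast at this
    exact this

/-! ### Points of order `14` on the Tate normal form -/

open WeierstrassCurve.Affine in
/-- With `c = s (r - 1)` and `b = r c`, the multiples of `P = (0, 0)` are `2 P = (b, b c)`,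
`3 P = (c, b - c)`, `4 P = (r (r - 1), r² (r - 1) (s - 1))` and `7 P = 3 P + 4 P`; the relation `h₁₄`
says that the tangent at `7 P` is vertical. -/
theorem isTatePair_fourteen {F : Type*} [Field F] {r s : F} (hr : r ≠ 0) (hs : s ≠ 0)
    (hr₁ : r - 1 ≠ 0) (hsr : s - r ≠ 0)
    (h₁₄ : r ^ 2 * (s ^ 3 - 5 * s ^ 2 + 6 * s - 1) +
      r * (s ^ 4 - 3 * s ^ 3 + 6 * s ^ 2 - 7 * s + 1) + s = 0)
    (hE : (tateNormalForm (r * (s * (r - 1))) (s * (r - 1))).IsElliptic) :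
    IsTatePair 14 (r * (s * (r - 1))) (s * (r - 1)) := by
  classical
  refine ⟨hE, ?_⟩
  have hb : r * (s * (r - 1)) ≠ 0 := mul_ne_zero hr (mul_ne_zero hs hr₁)
  set W := tateNormalForm (r * (s * (r - 1))) (s * (r - 1)) with hW
  have heq {x y : F} (h : y ^ 2 + (1 - s * (r - 1)) * x * y - r * (s * (r - 1)) * y =
      x ^ 3 - r * (s * (r - 1)) * x ^ 2) : W.toAffine.Nonsingular x y := by
    rw [← equation_iff_nonsingular, equation_iff]
    simp only [hW, tateNormalForm]
    linear_combination h
  have h1 : W.toAffine.Nonsingular 0 0 := heq (by ring)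
  have h2 : W.toAffine.Nonsingular (r * (s * (r - 1))) (r * (s * (r - 1)) * (s * (r - 1))) :=
    heq (by ring)
  have h3 : W.toAffine.Nonsingular (s * (r - 1)) (s * (r - 1) ^ 2) := heq (by ring)
  have h4 : W.toAffine.Nonsingular (r * (r - 1)) (r ^ 2 * (r - 1) * (s - 1)) := heq (by ring)
  have h7 : W.toAffine.Nonsingular
      (r * s * (r - 1) * (s - 1) * (r * s - 2 * r + 1) / (s - r) ^ 2)
      (r ^ 2 * s * (r - 1) ^ 2 * (s - 1) ^ 2 * (s ^ 2 - s + 1 - r) / (s - r) ^ 3) :=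
    heq (by field_simp; ring)
  have hP2 : 2 • Point.some 0 0 h1 = .some _ _ h2 := by
    refine Point.two_nsmul_some_eq _ ?_ 0 ?_ ?_ ?_ <;>
      simp only [negY, addX, hW, tateNormalForm]
    · exact fun h ↦ hb (by linear_combination -h)
    all_goals ring
  have hP3 : Point.some _ _ h2 + Point.some 0 0 h1 = .some _ _ h3 := by
    refine Point.some_add_some_eq _ hb (s * (r - 1)) (by ring) ?_ ?_ <;>
      simp only [negY, addX, hW, tateNormalForm] <;> ring
  have hP4 : 2 • Point.some _ _ h2 = .some _ _ h4 := by
    refine Point.two_nsmul_some_eq _ ?_ (r - 1 + s * (r - 1)) ?_ ?_ ?_ <;>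
      simp only [negY, addX, hW, tateNormalForm]
    · exact fun h ↦ mul_ne_zero hb (mul_ne_zero hs hr₁) (by linear_combination h)
    all_goals ring
  have hP7 : Point.some _ _ h3 + Point.some _ _ h4 = .some _ _ h7 := by
    refine Point.some_add_some_eq _ (fun h ↦ mul_ne_zero hr₁ hsr (by linear_combination h))
      ((s * (r - 1) - r ^ 2 * (s - 1)) / (s - r)) (by field_simp) ?_ ?_ <;>
      simp only [negY, addX, hW, tateNormalForm] <;> field_simp <;> ring
  have e3 : 3 • Point.some 0 0 h1 = .some _ _ h3 := by
    rw [← hP3, ← hP2, ← succ_nsmul]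
  have e4 : 4 • Point.some 0 0 h1 = .some _ _ h4 := by
    rw [← hP4, ← hP2, ← mul_nsmul]
  have e7 : 7 • Point.some 0 0 h1 = .some _ _ h7 := by
    rw [← hP7, ← e3, ← e4, ← add_nsmul]
  refine ⟨h1, addOrderOf_eq_of_nsmul_and_div_prime_nsmul (by norm_num) ?_ fun q hq hq14 ↦ ?_⟩
  · rw [show 14 = 7 * 2 from rfl, mul_nsmul, e7, two_nsmul]
    refine Point.add_self_of_Y_eq ?_
    simp only [negY, hW, tateNormalForm]
    refine sub_eq_zero.mp (Eq.trans ?_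
      (mul_eq_zero_of_right (r * s * (r - 1) ^ 2 / (s - r) ^ 3) h₁₄))
    field_simp
    ring
  · have : q ∈ Nat.primeFactors 14 := Nat.mem_primeFactors.mpr ⟨hq, hq14, by norm_num⟩
    have h14 : Nat.primeFactors 14 = {2, 7} := by decide +kernel
    simp only [h14, Finset.mem_insert, Finset.mem_singleton] at this
    rcases this with rfl | rfl
    · rw [show 14 / 2 = 7 from rfl, e7]
      exact Point.some_ne_zero h7
    · rw [show 14 / 7 = 2 from rfl, hP2]
      exact Point.some_ne_zero h2

/-! ### The function field of `X₁(14)` -/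

open Polynomial

namespace WeierstrassCurve.Affine.FunctionField

variable {F : Type*} [Field F] (W : WeierstrassCurve.Affine F)

/-- The coordinate function `x` on a Weierstrass curve. -/
noncomputable def x : W.FunctionField :=
  algebraMap W.CoordinateRing _ (algebraMap F[X] _ X)

/-- The coordinate function `y` on a Weierstrass curve. -/
noncomputable def y : W.FunctionField := algebraMap W.CoordinateRing _ (CoordinateRing.mk W Polynomial.X)

variable {W}

theorem algebraMap_smul_add_smul (p q : F[X]) :
    algebraMap W.CoordinateRing W.FunctionField
      (p • (1 : W.CoordinateRing) + q • CoordinateRing.mk W Polynomial.X) =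
      aeval (x W) p + aeval (x W) q * y W := by
  have h (p : F[X]) : algebraMap W.CoordinateRing W.FunctionField (CoordinateRing.mk W (C p)) =
      aeval (x W) p := by
    rw [x, aeval_algebraMap_apply, aeval_algebraMap_apply, aeval_X_left_apply]
    rfl
  rw [CoordinateRing.smul, CoordinateRing.smul, mul_one, map_add, map_mul, h, h, y]

theorem aeval_x_add_aeval_x_mul_y_ne_zero {p q : F[X]} (h : p ≠ 0 ∨ q ≠ 0) :
    aeval (x W) p + aeval (x W) q * y W ≠ 0 := by
  intro h0
  rw [← algebraMap_smul_add_smul, FaithfulSMul.algebraMap_eq_zero_iff] at h0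
  have := CoordinateRing.smul_basis_eq_zero h0
  tauto

theorem equation_x_y : y W ^ 2 + algebraMap F _ W.a₁ * x W * y W + algebraMap F _ W.a₃ * y W =
    x W ^ 3 + algebraMap F _ W.a₂ * x W ^ 2 + algebraMap F _ W.a₄ * x W + algebraMap F _ W.a₆ := by
  have key {L : Type _} [Field L] (φ : F[X][X] →+* L) (h : φ W.polynomial = 0) :
      φ X ^ 2 + φ (C (C W.a₁)) * φ (C X) * φ X + φ (C (C W.a₃)) * φ X =
        φ (C X) ^ 3 + φ (C (C W.a₂)) * φ (C X) ^ 2 + φ (C (C W.a₄)) * φ (C X) +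
          φ (C (C W.a₆)) := by
    rw [WeierstrassCurve.Affine.polynomial] at h
    simp only [map_mul, map_add, map_sub, map_pow] at h
    linear_combination h
  refine key ((algebraMap W.CoordinateRing W.FunctionField).comp (CoordinateRing.mk W)) ?_
  rw [RingHom.comp_apply, AdjoinRoot.mk_self, map_zero]

theorem adjoin_eq_top {S : Set W.FunctionField}
    (hx : x W ∈ IntermediateField.adjoin F S) (hy : y W ∈ IntermediateField.adjoin F S) :
    IntermediateField.adjoin F S = ⊤ := by
  have haeval (p : F[X]) : aeval (x W) p ∈ IntermediateField.adjoin F S :=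
    IntermediateField.aeval_coe _ ⟨x W, hx⟩ p ▸ SetLike.coe_mem _
  have hmem (f : W.CoordinateRing) :
      algebraMap W.CoordinateRing W.FunctionField f ∈ IntermediateField.adjoin F S := by
    obtain ⟨p, q, rfl⟩ := CoordinateRing.exists_smul_basis_eq f
    rw [algebraMap_smul_add_smul]
    exact add_mem (haeval p) (mul_mem (haeval q) hy)
  refine eq_top_iff.mpr fun z _ ↦ ?_
  obtain ⟨f, g, -, rfl⟩ := IsFractionRing.div_surjective (A := W.CoordinateRing) z
  exact div_mem (hmem f) (hmem g)

end WeierstrassCurve.Affine.FunctionField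

/-- The universal pair in terms of coordinates `x`, `y` on `X₁(14)`, such that `x` and `y` are in turn
rational functions of `b` and `c`. The assumption `hne` says that `x` is transcendental and that
`1, y` are linearly independent over `ℚ(x)`. -/
theorem exists_isTatePair_fourteen {L : Type*} [Field L] [Algebra ℚ L] {x y : L}
    (heq : y ^ 2 + x * y + y = x ^ 3 - x)
    (hne : ∀ p q : ℚ[X], p ≠ 0 ∨ q ≠ 0 → aeval x p + aeval x q * y ≠ 0) :
    ∃ b c : L, IsTatePair 14 b c ∧
      ∀ K : IntermediateField ℚ L, b ∈ K → c ∈ K → x ∈ K ∧ y ∈ K := by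
  have hX1 : (X + 1 : ℚ[X]) ≠ 0 := by simpa using X_add_C_ne_zero (1 : ℚ)
  have hne' (p q : ℚ[X]) (h : p ≠ 0 ∨ q ≠ 0) (z : L) (hz : aeval x p + aeval x q * y = z) :
      z ≠ 0 := hz ▸ hne p q h
  have hx0 : x ≠ 0 := hne' X 0 (.inl X_ne_zero) _ (by simp)
  have hx1 : x - 1 ≠ 0 := hne' (X - 1) 0
    (.inl (by simpa using X_sub_C_ne_zero (1 : ℚ))) _ (by simp [map_sub])
  have hk : x + 1 ≠ 0 := hne' (X + 1) 0 (.inl hX1) _ (by simp [map_add])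
  have hy0 : y ≠ 0 := hne' 0 1 (.inr one_ne_zero) _ (by simp)
  have hm : x ^ 2 + y ≠ 0 := hne' (X ^ 2) 1 (.inr one_ne_zero) _ (by simp [map_pow])
  have hn : x ^ 2 + x + y ≠ 0 := hne' (X ^ 2 + X) 1 (.inr one_ne_zero) _
    (by simp [map_pow, map_add])
  have hm1 : x ^ 2 + 1 + y ≠ 0 := hne' (X ^ 2 + 1) 1 (.inr one_ne_zero) _
    (by simp [map_pow, map_add])
  have hl : x + 1 + y ≠ 0 := hne' (X + 1) 1 (.inr one_ne_zero) _ (by simp [map_add])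
  have hc : x ^ 4 - 6 * x ^ 3 - 2 * x - 1 - (x + 1) ^ 2 * y ≠ 0 :=
    hne' (X ^ 4 - 6 * X ^ 3 - 2 * X - 1) (-(X + 1) ^ 2)
      (.inr (neg_ne_zero.mpr (pow_ne_zero 2 hX1))) _ (by
        simp only [map_sub, map_mul, map_pow, map_neg, map_add, map_one, map_ofNat, aeval_X]
        ring)
  obtain ⟨r, hr⟩ : ∃ r, r = y / ((x + 1) * (x ^ 2 + y)) := ⟨_, rfl⟩
  obtain ⟨s, hs⟩ : ∃ s, s = -y / (x + 1) := ⟨_, rfl⟩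
  have hr0 : r ≠ 0 := by
    rw [hr]
    exact div_ne_zero hy0 (mul_ne_zero hk hm)
  have hs0 : s ≠ 0 := by
    rw [hs]
    exact div_ne_zero (neg_ne_zero.mpr hy0) hk
  have hr1' : r - 1 = -(x * (x ^ 2 + x + y)) / ((x + 1) * (x ^ 2 + y)) := by
    rw [hr]
    field_simp
    ring
  have hr1 : r - 1 ≠ 0 := by
    rw [hr1']
    exact div_ne_zero (neg_ne_zero.mpr (mul_ne_zero hx0 hn)) (mul_ne_zero hk hm)
  have hs1' : s - 1 = -(x + 1 + y) / (x + 1) := by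
    rw [hs]
    field_simp
    ring
  have hs1 : s - 1 ≠ 0 := by
    rw [hs1']
    exact div_ne_zero (neg_ne_zero.mpr hl) hk
  have hsr : s - r ≠ 0 := by
    have : s - r = -(y * (x ^ 2 + 1 + y)) / ((x + 1) * (x ^ 2 + y)) := by
      rw [hr, hs]
      field_simp
      ring
    rw [this]
    exact div_ne_zero (neg_ne_zero.mpr (mul_ne_zero hy0 hm1)) (mul_ne_zero hk hm)
  have hcv : s * (r - 1) = y * x * (x ^ 2 + x + y) / ((x + 1) ^ 2 * (x ^ 2 + y)) := by
    rw [hr1', hs]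
    field_simp
  refine ⟨r * (s * (r - 1)), s * (r - 1), isTatePair_fourteen hr0 hs0 hr1 hsr ?_ ⟨?_⟩, ?_⟩
  · have hnum : y * (-y ^ 3 - 5 * y ^ 2 * (x + 1) - 6 * y * (x + 1) ^ 2 - (x + 1) ^ 3) +
        (x ^ 2 + y) * (y ^ 4 + 3 * y ^ 3 * (x + 1) + 6 * y ^ 2 * (x + 1) ^ 2 +
          7 * y * (x + 1) ^ 3 + (x + 1) ^ 4) - (x + 1) ^ 4 * (x ^ 2 + y) ^ 2 = 0 := by
      linear_combination (x ^ 5 + 4 * x ^ 4 + 3 * x ^ 3 * y + 6 * x ^ 3 + x ^ 2 * y ^ 2 + 6 * x ^ 2 * y + 4 * x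
      ^ 2 + 2 * x * y ^ 2 + 3 * x * y + x + y ^ 3 + y ^ 2) * heq
    refine Eq.trans ?_ (mul_eq_zero_of_right (y / ((x + 1) ^ 5 * (x ^ 2 + y) ^ 2)) hnum)
    rw [hr, hs]
    field_simp
    ring
  · have hΔ (b c : L) : (tateNormalForm b c).Δ =
        b ^ 3 * (16 * b ^ 2 - 8 * b * c ^ 2 - 20 * b * c + b - c * (1 - c) ^ 3) := by
      simp only [tateNormalForm, WeierstrassCurve.Δ, WeierstrassCurve.b₂, WeierstrassCurve.b₄,
        WeierstrassCurve.b₆, WeierstrassCurve.b₈]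
      ring
    rw [hΔ, isUnit_iff_ne_zero]
    -- On the curve, the second factor of the discriminant is a product of functions that vanish
    -- only at cusps.
    refine mul_ne_zero (pow_ne_zero 3 (mul_ne_zero hr0 (mul_ne_zero hs0 hr1))) ?_
    have hnum : 16 * (y ^ 2 * x * (x ^ 2 + x + y)) ^ 2 * (x + 1) ^ 2 -
        8 * (y ^ 2 * x * (x ^ 2 + x + y)) * (y * x * (x ^ 2 + x + y)) ^ 2 * (x + 1) -
        20 * (y ^ 2 * x * (x ^ 2 + x + y)) * (y * x * (x ^ 2 + x + y)) * (x + 1) ^ 3 *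
          (x ^ 2 + y) +
        (y ^ 2 * x * (x ^ 2 + x + y)) * (x + 1) ^ 5 * (x ^ 2 + y) ^ 2 -
        (y * x * (x ^ 2 + x + y)) *
          ((x + 1) ^ 2 * (x ^ 2 + y) - y * x * (x ^ 2 + x + y)) ^ 3 =
        (x + 1) ^ 4 * x ^ 9 * (x - 1) *
          (x ^ 4 - 6 * x ^ 3 - 2 * x - 1 - (x + 1) ^ 2 * y) := by
      linear_combination (x ^ 15 - 3 * x ^ 14 - 15 * x ^ 13 + x ^ 12 * y ^ 2 - 6 * x ^ 12 * y - 19 * x ^ 12 - 6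
      * x ^ 11 * y ^ 2 - 20 * x ^ 11 * y - 13 * x ^ 11 + 4 * x ^ 10 * y ^ 3 - 34 * x ^ 10 *
      y ^ 2 - 24 * x ^ 10 * y - 9 * x ^ 10 - 8 * x ^ 9 * y ^ 3 - 70 * x ^ 9 * y ^ 2 - 12 * x
      ^ 9 * y - 5 * x ^ 9 + 6 * x ^ 8 * y ^ 4 - 66 * x ^ 8 * y ^ 3 - 79 * x ^ 8 * y ^ 2 - 2
      * x ^ 8 * y - 1 * x ^ 8 - 3 * x ^ 7 * y ^ 4 - 120 * x ^ 7 * y ^ 3 - 50 * x ^ 7 * y ^ 2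
      + 4 * x ^ 6 * y ^ 5 - 52 * x ^ 6 * y ^ 4 - 101 * x ^ 6 * y ^ 3 - 16 * x ^ 6 * y ^ 2 -
      72 * x ^ 5 * y ^ 4 - 43 * x ^ 5 * y ^ 3 - 2 * x ^ 5 * y ^ 2 + x ^ 4 * y ^ 6 - 15 * x ^
      4 * y ^ 5 - 33 * x ^ 4 * y ^ 4 - 9 * x ^ 4 * y ^ 3 - 11 * x ^ 3 * y ^ 5 - 5 * x ^ 3 *
      y ^ 4 - 1 * x ^ 3 * y ^ 3 - 1 * x ^ 2 * y ^ 4) * heq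
    have hval : 16 * (r * (s * (r - 1))) ^ 2 - 8 * (r * (s * (r - 1))) * (s * (r - 1)) ^ 2 -
        20 * (r * (s * (r - 1))) * (s * (r - 1)) + r * (s * (r - 1)) -
        s * (r - 1) * (1 - s * (r - 1)) ^ 3 =
        (x + 1) ^ 4 * x ^ 9 * (x - 1) *
          (x ^ 4 - 6 * x ^ 3 - 2 * x - 1 - (x + 1) ^ 2 * y) /
          ((x + 1) ^ 8 * (x ^ 2 + y) ^ 4) := by
      rw [hcv, hr, ← hnum]
      field_simp
    rw [hval]
    exact div_ne_zero (mul_ne_zero (mul_ne_zero (mul_ne_zero (pow_ne_zero 4 hk)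
      (pow_ne_zero 9 hx0)) hx1) hc) (mul_ne_zero (pow_ne_zero 8 hk) (pow_ne_zero 4 hm))
  · intro K hbK hcK
    have hsr' : s / r = -(x ^ 2 + y) := by
      rw [hr, hs]
      field_simp
    have hxrs : x = (s * (2 - s) - s / r) / (s - 1) ^ 2 := by
      rw [eq_div_iff (pow_ne_zero 2 hs1), hsr', hs1', hs]
      field_simp
      linear_combination (x + 1) * heq
    have hyrs : y = -s * (x + 1) := by
      rw [hs]
      field_simp
    have hrK : r ∈ K := by
      have := div_mem hbK hcK
      rwa [mul_div_cancel_right₀ _ (mul_ne_zero hs0 hr1)] at this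
    have hsK : s ∈ K := by
      have := div_mem hcK (sub_mem hrK (one_mem K))
      rwa [mul_div_cancel_right₀ _ hr1] at this
    have hxK : x ∈ K := by
      rw [hxrs]
      exact div_mem (sub_mem (mul_mem hsK (sub_mem (ofNat_mem K 2) hsK)) (div_mem hsK hrK))
        (pow_mem (sub_mem hsK (one_mem K)) 2)
    refine ⟨hxK, ?_⟩
    rw [hyrs]
    exact mul_mem (neg_mem hsK) (add_mem hxK (one_mem K))

open WeierstrassCurve.Affine.FunctionField in
theorem isModularCurveX1_fourteen : IsModularCurveX1 14 X1_14 := by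
  refine ⟨⟨?_⟩, ?_⟩
  · have : X1_14.Δ = -28 := by
      norm_num [WeierstrassCurve.Δ, WeierstrassCurve.b₂, WeierstrassCurve.b₄, WeierstrassCurve.b₆,
        WeierstrassCurve.b₈, X1_14]
    rw [this]
    exact (by norm_num : (-28 : ℚ) ≠ 0).isUnit
  have heq := equation_x_y (W := X1_14.toAffine)
  change _ + algebraMap ℚ _ (1 : ℚ) * _ * _ + algebraMap ℚ _ (1 : ℚ) * _ =
    _ + algebraMap ℚ _ (0 : ℚ) * _ + algebraMap ℚ _ (-1 : ℚ) * _ + algebraMap ℚ _ (0 : ℚ) at heq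
  rw [map_one, map_zero, map_neg, map_one, one_mul, one_mul, zero_mul, add_zero, add_zero,
    neg_one_mul, ← sub_eq_add_neg] at heq
  obtain ⟨b, c, hbc, hK⟩ := exists_isTatePair_fourteen heq
    fun p q ↦ aeval_x_add_aeval_x_mul_y_ne_zero
  refine ⟨b, c, hbc, ?_⟩
  obtain ⟨hx, hy⟩ := hK (IntermediateField.adjoin ℚ {b, c})
    (IntermediateField.subset_adjoin _ _ (.inl rfl))
    (IntermediateField.subset_adjoin _ _ (.inr rfl))
  exact adjoin_eq_top hx hy

theorem theorem3 :
    IsModularCurveX1 14 X1_14 ∧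
      ∀ p : ℕ, p.Prime → p ≡ 3 [MOD 8] → legendreSym 7 (p : ℤ) = 1 →
        (X1_14.quadraticTwist (p : ℚ)).rankQ = 0 ∧
        (X1_14.quadraticTwist (-7 * (p : ℚ))).rankQ = 0 :=
  ⟨isModularCurveX1_fourteen, fun _ hp h8 h7 ↦ (TwistPrime.of_legendreSym hp h8 h7).rankQ_eq_zero⟩
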